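/- Let $d\ge 1$, $D=\{1,\dots,d\}$, and let $X=(X_1,\dots,X_d)$ be a random vector following the asymmetric logistic extreme value model in standard Fréchet margins with all dependence parameters equal to some $\alpha\in(0,1)$, that is, $\Pr(X_1\le x_1,\dots,X_d\le x_d)=\exp\{-V(x)\}$ for all $x\in(0,\infty)^d$, where $$V(x)=\sum_{\emptyset\ne C\subseteq D}\Big\{\sum_{i\in C}\Big(\frac{\theta_{i,C}}{x_i}\Big)^{1/\alpha}\Big\}^{\alpha},$$ with weights $\theta_{i,C}\in[0,1]$ such that $\theta_{i,C}=0$ if $i\notin C$ and $\sum_{\emptyset\ne C\subseteq D}\theta_{i,C}=1$ for every $i\in D$. Assume that for each non-empty $C\subseteq D$ either $\theta_{i,C}>0$ for all $i\in C$ or $\theta_{i,C}=0$ for all $i\in C$. Put $R=\sum_{i=1}^d X_i$, $W=X/R$, and let $\mathcal S_{d-1}=\{w\in[0,1]^d:\sum_i w_i=1\}$. A spectral measure of $X$ is a Borel probability measure $H$ on $\mathcal S_{d-1}$ such that $$\lim_{t\to\infty}\Pr(R>tr,\;W\in B\mid R>t)=H(B)\,r^{-1}$$ for all $r\ge 1$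 and all Borel sets $B\subseteq\mathcal S_{d-1}$ whose boundary relative to $\mathcal S_{d-1}$ is $H$-null. For non-empty $C\subseteq D$, the proportion of extremal mass on the cone $\mathbb E_C=\{x\in[0,\infty]^d\setminus\{0\}: x_i>0 \text{ for } i\in C,\ x_j=0 \text{ for } j\in D\setminus C\}$ is $p_C=H(\mathbb B_C)$, where $\mathbb B_C=\{w\in\mathcal S_{d-1}: w_i\in(0,1] \text{ for } i\in C,\ w_j=0 \text{ for } j\in D\setminus C\}$. Then $X$ has a spectral measure, and for every spectral measure $H$ of $X$ and every non-empty $C\subseteq D$, $$p_C=\frac1d\sum_{i\in C}\theta_{i,C}.$$ -/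

import Mathlib

open MeasureTheory ProbabilityTheory Filter Topology

noncomputable section

namespace AsymLogistic

/-- The exponent measure
`V(x) = ∑_{C ∈ 2^D \ ∅} (∑_{i ∈ C} (θ_{i,C} / x_i)^{1/α_C})^{α_C}`, where `D = Fin d`,
of the asymmetric logistic model, used for `x` with positive coordinates. -/
def exponent {d : ℕ} (α : Finset (Fin d) → ℝ) (θ : Fin d → Finset (Fin d) → ℝ)
    (x : Fin d → ℝ) : ℝ :=
  ∑ C ∈ (Finset.univ : Finset (Finset (Fin d))).filter (fun C => C.Nonempty),
    (∑ i ∈ C, (θ i C / x i) ^ (1 / α C)) ^ (α C)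

/-- The constraints on the weights: `θ_{i,C} ∈ [0,1]`, `θ_{i,C} = 0` for `i ∉ C`, and
`∑_{C ∈ 2^D \ ∅} θ_{i,C} = 1` for all `i`. -/
structure IsWeights {d : ℕ} (θ : Fin d → Finset (Fin d) → ℝ) : Prop where
  mem_Icc : ∀ i C, θ i C ∈ Set.Icc (0 : ℝ) 1
  eq_zero_of_notMem : ∀ i C, i ∉ C → θ i C = 0
  sum_eq_one : ∀ i,
    ∑ C ∈ (Finset.univ : Finset (Finset (Fin d))).filter (fun C => C.Nonempty), θ i C = 1

/-- The random vector `X` follows the asymmetric logistic extreme value model with standard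
Fréchet margins: its joint distribution function is `exp (-V)` on the positive orthant. -/
structure IsModel {d : ℕ} {Ω : Type*} [MeasurableSpace Ω] (P : Measure Ω)
    (X : Ω → Fin d → ℝ) (α : Finset (Fin d) → ℝ) (θ : Fin d → Finset (Fin d) → ℝ) : Prop where
  measurable : Measurable X
  cdf_eq : ∀ x : Fin d → ℝ, (∀ i, 0 < x i) →
    P.real {ω | ∀ i, X ω i ≤ x i} = Real.exp (-exponent α θ x)

/-- The radial component `R = ∑ i, X i`. -/
def radius {d : ℕ} {Ω : Type*} (X : Ω → Fin d → ℝ) (ω : Ω) : ℝ := ∑ i, X ω i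

/-- The angular component `W = X / R`. -/
def angle {d : ℕ} {Ω : Type*} (X : Ω → Fin d → ℝ) (ω : Ω) : Fin d → ℝ :=
  fun i => X ω i / radius X ω

/-- `H` is the spectral measure of `X`: a probability measure on the unit simplex with
`lim_{t → ∞} pr(R > t r, W ∈ B | R > t) = H(B) r⁻¹` for all `r ≥ 1` and all Borel subsets `B` of
the simplex whose relative boundary is `H`-null (this is weak convergence). -/
structure IsSpectralMeasure {d : ℕ} {Ω : Type*} [MeasurableSpace Ω] (P : Measure Ω)
    (X : Ω → Fin d → ℝ) (H : Measure (stdSimplex ℝ (Fin d))) : Prop where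
  isProbabilityMeasure : IsProbabilityMeasure H
  tendsto : ∀ B : Set (stdSimplex ℝ (Fin d)), MeasurableSet B → H (frontier B) = 0 →
    ∀ r : ℝ, 1 ≤ r →
      Tendsto (fun t : ℝ => (ProbabilityTheory.cond P {ω | t < radius X ω}).real
          {ω | t * r < radius X ω ∧ angle X ω ∈ Subtype.val '' B})
        atTop (𝓝 (H.real B * r⁻¹))

/-- The face of the unit simplex that corresponds to the cone `E_C`:
the points `w` with `w_i ∈ (0,1]` for `i ∈ C` and `w_j = 0` for `j ∉ C`. -/
def face {d : ℕ} (C : Finset (Fin d)) : Set (stdSimplex ℝ (Fin d)) :=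
  {w | (∀ i ∈ C, (w : Fin d → ℝ) i ∈ Set.Ioc (0 : ℝ) 1) ∧ ∀ j, j ∉ C → (w : Fin d → ℝ) j = 0}

/-- The proportion of extremal mass on the cone `E_C` when the spectral measure is `H`. -/
def coneMass {d : ℕ} (H : Measure (stdSimplex ℝ (Fin d))) (C : Finset (Fin d)) : ℝ :=
  H.real (face C)

end AsymLogistic

end

/-!
The proof replaces the distribution function `exp (-V)` by an explicit description of its limiting
exponent measure. Let `Y i` be independent Fréchet variables with shape `1 / α`, normalized to have
mean one, and let `M` be the sum over all non-empty `C` of the laws of `(θ i C * Y i)ᵢ`. Since a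
weighted maximum of independent Fréchet variables is again Fréchet, scaled by the `ℓ^(1/α)`-norm of
the weights (`lintegral_iSup_frechet`), `V y = ∫ maxᵢ (zᵢ / yᵢ) dM(z)`
(`isGenerator_generator`).

The image `Λ` of `M × Leb(0, ∞)` under `(z, u) ↦ u⁻¹ z` then gives mass `V y` to the complement of
the orthant `{x ≤ y}`, and it factorizes in polar coordinates into `d r⁻¹` times the angular measure
`H(B) = d⁻¹ ∫ ‖z‖₁ 1{z / ‖z‖₁ ∈ B} dM(z)` (`exponentMeasure_polarSet_eq_angularMeasure`). Because
`t (1 - exp (-V y / t)) → V y`, the law of `X / t`, conditioned on one coordinate exceeding `1 / d`,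
converges to `Λ` conditioned in the same way at all points with non-zero coordinates, hence weakly
(`tendsto_probabilityMeasure_of_tendsto_Iic`). Evaluating the limit on sets in polar coordinates
shows that `H` is a spectral measure (`IsGenerator.isSpectralMeasure`), and a spectral measure is
determined by its values on null-boundary sets (`IsSpectralMeasure.unique`).

Finally, the component of `M` indexed by `C'` is almost surely zero or has exactly the coordinates
in `C'` positive, so only `C' = C` charges the face `C`, with mass `d⁻¹ ∑ i ∈ C, θ i C`
(`angularMeasure_generator_face`).
-/

namespace AsymLogistic

/-! ### Weak convergence from convergence of distribution functions -/

section WeakConvergence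

variable {ι κ : Type*}

lemma pi_Ioc_eq_Iic_diff [Fintype κ] [DecidableEq κ] (a b : κ → ℝ) :
    Set.univ.pi (fun i => Set.Ioc (a i) (b i)) =
      Set.Iic b \ ⋃ A ∈ Finset.univ.image
        (fun i => Set.Iic (Function.update b i (min (a i) (b i)))), A := by
  ext x
  simp only [Set.mem_pi, Set.mem_univ, true_imp_iff, Set.mem_Ioc, Set.mem_sdiff, Set.mem_Iic,
    Finset.mem_image, Finset.mem_univ, true_and, Set.iUnion_exists, Set.iUnion_iUnion_eq',
    Set.mem_iUnion, not_exists]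
  refine ⟨fun h => ⟨fun i => (h i).2, fun i hi => ?_⟩, fun h i => ⟨?_, h.1 i⟩⟩
  · have := hi i
    simp only [Function.update_self, le_min_iff] at this
    exact absurd (h i).1 (not_lt.2 this.1)
  · by_contra hi
    refine h.2 i fun j => ?_
    rcases eq_or_ne j i with rfl | hj
    · simpa using ⟨not_lt.1 hi, h.1 j⟩
    · simpa [hj] using h.1 j

lemma isPiSystem_Iic_of_mem (s : Set ℝ) :
    IsPiSystem {A : Set (κ → ℝ) | ∃ y : κ → ℝ, (∀ i, y i ∈ s) ∧ A = Set.Iic y} := by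
  rintro _ ⟨a, ha, rfl⟩ _ ⟨b, hb, rfl⟩ -
  refine ⟨a ⊓ b, fun i => ?_, Set.Iic_inter_Iic⟩
  rcases min_choice (a i) (b i) with h | h <;> simp [Pi.inf_apply, h, ha i, hb i]

lemma isPiSystem_pi_Ioc_of_mem (s : Set ℝ) :
    IsPiSystem {A : Set (κ → ℝ) | ∃ a b : κ → ℝ, (∀ i, a i ∈ s) ∧ (∀ i, b i ∈ s) ∧
      A = Set.univ.pi fun i => Set.Ioc (a i) (b i)} := by
  rintro _ ⟨a, b, ha, hb, rfl⟩ _ ⟨a', b', ha', hb', rfl⟩ -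
  refine ⟨a ⊔ a', b ⊓ b', fun i => ?_, fun i => ?_, ?_⟩
  · rcases max_choice (a i) (a' i) with h | h <;> simp [Pi.sup_apply, h, ha i, ha' i]
  · rcases min_choice (b i) (b' i) with h | h <;> simp [Pi.inf_apply, h, hb i, hb' i]
  · rw [← Set.pi_inter_distrib]
    simp only [Set.Ioc_inter_Ioc, Pi.sup_apply, Pi.inf_apply]

/-- Convergence of the distribution functions at all points with coordinates in a dense set `s`
implies weak convergence: boxes with corners in `s` are differences of finite unions of
orthants, and they form a π-system containing arbitrarily small neighbourhoods. -/
theorem tendsto_probabilityMeasure_of_tendsto_Iic [Fintype κ] {μ : ι → ProbabilityMeasure (κ → ℝ)}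
    {ν : ProbabilityMeasure (κ → ℝ)} {l : Filter ι} [l.IsCountablyGenerated] {s : Set ℝ}
    (hs : Dense s)
    (h : ∀ y : κ → ℝ, (∀ i, y i ∈ s) →
      Tendsto (fun j => (μ j : Measure (κ → ℝ)).real (Set.Iic y)) l
        (𝓝 ((ν : Measure (κ → ℝ)).real (Set.Iic y)))) :
    Tendsto μ l (𝓝 ν) := by
  classical
  refine (isPiSystem_pi_Ioc_of_mem s).tendsto_probabilityMeasure_of_tendsto_of_mem ?_ ?_ ?_
  · rintro _ ⟨a, b, -, -, rfl⟩
    exact MeasurableSet.univ_pi fun i => measurableSet_Ioc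
  · intro u hu x hx
    obtain ⟨ε, hε, hεu⟩ := Metric.isOpen_iff.1 hu x hx
    choose a ha using fun i => hs.exists_between (show x i - ε < x i by linarith)
    choose b hb using fun i => hs.exists_between (show x i < x i + ε by linarith)
    refine ⟨_, ⟨a, b, fun i => (ha i).1, fun i => (hb i).1, rfl⟩, ?_, ?_⟩
    · exact set_pi_mem_nhds Set.finite_univ fun i _ => Ioc_mem_nhds (ha i).2.2 (hb i).2.1
    · refine fun y hy => hεu ((dist_pi_lt_iff hε).2 fun i => ?_)
      have hyi := hy i trivial
      rw [Real.dist_eq, abs_lt]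
      constructor <;> linarith [hyi.1, hyi.2, (ha i).2.1, (hb i).2.2]
  · rintro _ ⟨a, b, ha, hb, rfl⟩
    set T : Finset (Set (κ → ℝ)) := Finset.univ.image
      (fun i => Set.Iic (Function.update b i (min (a i) (b i)))) with hT
    have hTS : ∀ A ∈ T, A ∈ {A : Set (κ → ℝ) | ∃ y : κ → ℝ, (∀ i, y i ∈ s) ∧ A = Set.Iic y} := by
      intro A hA
      obtain ⟨i, -, rfl⟩ := Finset.mem_image.1 hA
      refine ⟨_, fun j => ?_, rfl⟩
      rcases eq_or_ne j i with rfl | hj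
      · rcases min_choice (a j) (b j) with h | h <;> simp [h, ha j, hb j]
      · simpa [hj] using hb j
    have hU : Tendsto (fun j => (μ j : Measure (κ → ℝ)).real (⋃ A ∈ T, A)) l
        (𝓝 ((ν : Measure (κ → ℝ)).real (⋃ A ∈ T, A))) := by
      refine (isPiSystem_Iic_of_mem s).tendsto_measureReal_biUnion hTS ?_ ?_
      · rintro _ ⟨y, -, rfl⟩
        exact measurableSet_Iic
      · rintro _ ⟨y, hy, rfl⟩
        exact h y hy
    have hsub : (⋃ A ∈ T, A) ⊆ Set.Iic b := by
      refine Set.iUnion₂_subset fun A hA => ?_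
      obtain ⟨i, -, rfl⟩ := Finset.mem_image.1 hA
      refine Set.Iic_subset_Iic.2 fun j => ?_
      rcases eq_or_ne j i with rfl | hj
      · simp
      · simp [hj]
    have hm : MeasurableSet (⋃ A ∈ T, A) := by
      refine T.measurableSet_biUnion fun A hA => ?_
      obtain ⟨y, -, rfl⟩ := hTS A hA
      exact measurableSet_Iic
    have key := (h b hb).sub hU
    rw [← NNReal.tendsto_coe]
    rw [pi_Ioc_eq_Iic_diff]
    simp only [← hT]
    have e : ∀ m : ProbabilityMeasure (κ → ℝ), ((m (Set.Iic b \ ⋃ A ∈ T, A) : NNReal) : ℝ) =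
        (m : Measure (κ → ℝ)).real (Set.Iic b) - (m : Measure (κ → ℝ)).real (⋃ A ∈ T, A) := by
      intro m
      rw [← measureReal_sdiff hsub hm]
      rfl
    simpa only [e] using key

end WeakConvergence

/-! ### Polar coordinates on the nonnegative orthant -/

section Polar

variable {d : ℕ}

/-- The sum of the positive parts of the coordinates: the radius of a nonnegative vector,
extended to a continuous function on the whole space. -/
noncomputable def posSum (x : Fin d → ℝ) : ℝ := ∑ i, max (x i) 0

lemma posSum_nonneg (x : Fin d → ℝ) : 0 ≤ posSum x :=
  Finset.sum_nonneg fun _ _ => le_max_right _ _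

lemma posSum_eq_sum {x : Fin d → ℝ} (hx : ∀ i, 0 ≤ x i) : posSum x = ∑ i, x i :=
  Finset.sum_congr rfl fun i _ => max_eq_left (hx i)

lemma posSum_smul {c : ℝ} (hc : 0 ≤ c) (x : Fin d → ℝ) : posSum (c • x) = c * posSum x := by
  simp only [posSum, Finset.mul_sum, Pi.smul_apply, smul_eq_mul, mul_max_of_nonneg _ _ hc, mul_zero]

lemma continuous_posSum : Continuous (posSum : (Fin d → ℝ) → ℝ) := by
  unfold posSum
  fun_prop

lemma ofReal_posSum (x : Fin d → ℝ) :
    ENNReal.ofReal (posSum x) = ∑ i, ENNReal.ofReal (x i) := by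
  rw [posSum, ENNReal.ofReal_sum_of_nonneg fun _ _ => le_max_right _ _]
  simp [ENNReal.ofReal_max]

variable [NeZero d]

/-- The point of the unit simplex on the ray through the positive part of `x`. When no coordinate
of `x` is positive, the value is an arbitrary vertex. -/
noncomputable def simplexAngle (x : Fin d → ℝ) : stdSimplex ℝ (Fin d) :=
  if h : 0 < posSum x then
    ⟨fun i => max (x i) 0 / posSum x, fun i => div_nonneg (le_max_right _ _) h.le, by
      rw [← Finset.sum_div]
      exact div_self h.ne'⟩
  else ⟨Pi.single 0 1, single_mem_stdSimplex ℝ 0⟩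

lemma coe_simplexAngle {x : Fin d → ℝ} (hx : 0 < posSum x) :
    (simplexAngle x : Fin d → ℝ) = fun i => max (x i) 0 / posSum x := by
  rw [simplexAngle, dif_pos hx]
  rfl

lemma simplexAngle_smul {c : ℝ} (hc : 0 < c) (x : Fin d → ℝ) :
    simplexAngle (c • x) = simplexAngle x := by
  by_cases h : 0 < posSum x
  · have h' : 0 < posSum (c • x) := by
      rw [posSum_smul hc.le]
      positivity
    ext i
    rw [coe_simplexAngle h, coe_simplexAngle h', posSum_smul hc.le]
    simp only [Pi.smul_apply, smul_eq_mul]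
    rw [← mul_div_mul_left _ (posSum x) hc.ne', mul_max_of_nonneg _ _ hc.le, mul_zero]
  · have h' : ¬ 0 < posSum (c • x) := by
      rw [posSum_smul hc.le]
      intro h'
      exact h (pos_of_mul_pos_right h' hc.le)
    rw [simplexAngle, simplexAngle, dif_neg h, dif_neg h']

lemma continuousOn_simplexAngle :
    ContinuousOn (simplexAngle : (Fin d → ℝ) → stdSimplex ℝ (Fin d)) {x | 0 < posSum x} := by
  rw [continuousOn_iff_continuous_domRestrict, continuous_induced_rng]
  have : (Subtype.val ∘ Set.domRestrict {x : Fin d → ℝ | 0 < posSum x} simplexAngle) =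
      fun x => fun i => max (x.1 i) 0 / posSum x.1 := by
    funext x
    exact coe_simplexAngle x.2
  rw [this]
  refine continuous_pi fun i => Continuous.div ?_ ?_ fun x => ne_of_gt x.2
  · exact ((continuous_apply i).comp continuous_subtype_val).max continuous_const
  · exact continuous_posSum.comp continuous_subtype_val

lemma measurable_simplexAngle :
    Measurable (simplexAngle : (Fin d → ℝ) → stdSimplex ℝ (Fin d)) := by
  have h : Measurable fun x : Fin d → ℝ =>
      if 0 < posSum x then fun i => max (x i) 0 / posSum x else Pi.single 0 1 := by
    refine Measurable.ite (measurableSet_lt measurable_const continuous_posSum.measurable) ?_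
      measurable_const
    have := continuous_posSum (d := d) |>.measurable
    fun_prop
  have hval : ∀ x : Fin d → ℝ, (simplexAngle x).1 =
      if 0 < posSum x then fun i => max (x i) 0 / posSum x else Pi.single 0 1 := by
    intro x
    rw [simplexAngle]
    split_ifs <;> rfl
  simp only [← hval] at h
  exact h.subtype_mk (h := fun x => (simplexAngle x).2)

/-- The set of vectors with radius greater than `r` and angle in `B`. -/
def polarSet (r : ℝ) (B : Set (stdSimplex ℝ (Fin d))) : Set (Fin d → ℝ) :=
  {x | r < posSum x ∧ simplexAngle x ∈ B}

lemma measurableSet_polarSet (r : ℝ) {B : Set (stdSimplex ℝ (Fin d))} (hB : MeasurableSet B) :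
    MeasurableSet (polarSet r B) :=
  (measurableSet_lt measurable_const continuous_posSum.measurable).inter
    (measurable_simplexAngle hB)

/-- Away from the points without positive coordinates, polar coordinates are continuous, hence
the frontier of a set in polar coordinates consists of points with critical radius or angle. -/
lemma frontier_polarSet_subset {r : ℝ} (hr : 0 < r) (B : Set (stdSimplex ℝ (Fin d))) :
    frontier (polarSet r B) ⊆
      {x | posSum x = r} ∪ {x | 0 < posSum x ∧ simplexAngle x ∈ frontier B} := by
  intro x hx
  have hrx : r ≤ posSum x :=
    closure_minimal (fun y hy => le_of_lt hy.1)
      (isClosed_le continuous_const continuous_posSum) hx.1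
  rcases hrx.eq_or_lt with h | h
  · exact Or.inl h.symm
  have h0 : 0 < posSum x := hr.trans h
  have hcont : ContinuousAt simplexAngle x :=
    continuousOn_simplexAngle.continuousAt
      ((isOpen_lt continuous_const continuous_posSum).mem_nhds h0)
  refine Or.inr ⟨h0, ?_, fun hint => hx.2 ?_⟩
  · refine mem_closure_iff_nhds.2 fun U hU => ?_
    obtain ⟨y, hyU, hy⟩ := mem_closure_iff_nhds.1 hx.1 _ (hcont hU)
    exact ⟨_, hyU, hy.2⟩
  · rw [mem_interior_iff_mem_nhds] at hint ⊢
    filter_upwards [hcont hint, (isOpen_lt continuous_const continuous_posSum).mem_nhds h]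
      with y hy hy'
    exact ⟨hy', hy⟩

end Polar

/-! ### The exponent measure generated by a random direction -/

section ExponentMeasure

variable {d : ℕ}

/-- The image of `M × Leb(0, ∞)` under `(z, u) ↦ u⁻¹ z`. It is homogeneous of order `-1`, and
a set `{1 < G}` with `G` homogeneous of order `1` has mass `∫ G dM`. -/
noncomputable def exponentMeasure (M : Measure (Fin d → ℝ)) : Measure (Fin d → ℝ) :=
  (M.prod (volume.restrict (Set.Ioi (0 : ℝ)))).map fun p => p.2⁻¹ • p.1

lemma measurable_inv_smul :
    Measurable fun p : (Fin d → ℝ) × ℝ => p.2⁻¹ • p.1 := by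
  fun_prop

lemma exponentMeasure_apply (M : Measure (Fin d → ℝ)) {A : Set (Fin d → ℝ)}
    (hA : MeasurableSet A) :
    exponentMeasure M A = ∫⁻ z, volume {u : ℝ | 0 < u ∧ u⁻¹ • z ∈ A} ∂M := by
  rw [exponentMeasure, Measure.map_apply measurable_inv_smul hA,
    Measure.prod_apply (measurable_inv_smul hA)]
  refine lintegral_congr fun z => ?_
  have hm : MeasurableSet (Prod.mk z ⁻¹' ((fun p : (Fin d → ℝ) × ℝ => p.2⁻¹ • p.1) ⁻¹' A)) :=
    measurable_prodMk_left (measurable_inv_smul hA)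
  rw [Measure.restrict_apply hm]
  congr 1
  ext u
  simp [and_comm]

lemma volume_pos_ofReal_lt (c : ENNReal) :
    volume {u : ℝ | 0 < u ∧ ENNReal.ofReal u < c} = c := by
  rcases eq_or_ne c ⊤ with rfl | hc
  · have : {u : ℝ | 0 < u ∧ ENNReal.ofReal u < ⊤} = Set.Ioi 0 := by
      ext u
      simp
    rw [this, Real.volume_Ioi]
  · have : {u : ℝ | 0 < u ∧ ENNReal.ofReal u < c} = Set.Ioo 0 c.toReal := by
      ext u
      simp only [Set.mem_ofPred_eq, Set.mem_Ioo]
      refine and_congr_right fun hu => ?_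
      rw [ENNReal.ofReal_lt_iff_lt_toReal hu.le hc]
    rw [this, Real.volume_Ioo, sub_zero, ENNReal.ofReal_toReal hc]

/-- The mass of the part of a cone `K` where a function `G` that is homogeneous of order `1`
exceeds `1`. -/
lemma exponentMeasure_inter_cone (M : Measure (Fin d → ℝ)) {G : (Fin d → ℝ) → ENNReal}
    (hG : Measurable G) (hGu : ∀ u : ℝ, 0 < u → ∀ z, G (u⁻¹ • z) = G z / ENNReal.ofReal u)
    {K : Set (Fin d → ℝ)} (hK : MeasurableSet K)
    (hKu : ∀ u : ℝ, 0 < u → ∀ z, u⁻¹ • z ∈ K ↔ z ∈ K) :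
    exponentMeasure M ({x | 1 < G x} ∩ K) = ∫⁻ z in K, G z ∂M := by
  rw [exponentMeasure_apply M ((measurableSet_lt measurable_const hG).inter hK),
    ← lintegral_indicator hK]
  refine lintegral_congr fun z => ?_
  by_cases hz : z ∈ K
  · rw [Set.indicator_of_mem hz, ← volume_pos_ofReal_lt (G z)]
    congr 1
    ext u
    simp only [Set.mem_ofPred_eq, Set.mem_inter_iff]
    refine and_congr_right fun hu => ?_
    rw [hKu u hu, hGu u hu, ENNReal.lt_div_iff_mul_lt (by simp [hu]) (by simp), one_mul]
    simp [hz]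
  · rw [Set.indicator_of_notMem hz]
    convert measure_empty (μ := (volume : Measure ℝ))
    ext u
    simp only [Set.mem_ofPred_eq, Set.mem_inter_iff, Set.mem_empty_iff_false, iff_false]
    rintro ⟨hu, -, h⟩
    exact hz ((hKu u hu z).1 h)

lemma ae_exponentMeasure_of_cone {M : Measure (Fin d → ℝ)} [SFinite M] {K : Set (Fin d → ℝ)}
    (hK : MeasurableSet K) (hKu : ∀ u : ℝ, 0 < u → ∀ z ∈ K, u⁻¹ • z ∈ K)
    (h : ∀ᵐ z ∂M, z ∈ K) : ∀ᵐ x ∂exponentMeasure M, x ∈ K := by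
  rw [exponentMeasure, ae_map_iff (p := (· ∈ K)) measurable_inv_smul.aemeasurable hK]
  have h1 := (Measure.quasiMeasurePreserving_fst (μ := M)
    (ν := volume.restrict (Set.Ioi (0 : ℝ)))).ae h
  have h2 := (Measure.quasiMeasurePreserving_snd (μ := M)
    (ν := volume.restrict (Set.Ioi (0 : ℝ)))).ae (ae_restrict_mem measurableSet_Ioi)
  filter_upwards [h1, h2] with p hp hp'
  exact hKu _ hp' _ hp

lemma exponentMeasure_posSum_eq (M : Measure (Fin d → ℝ)) {r : ℝ} (hr : 0 < r) :
    exponentMeasure M {x | posSum x = r} = 0 := by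
  rw [exponentMeasure_apply M (measurableSet_eq_fun continuous_posSum.measurable measurable_const),
    lintegral_eq_zero_of_ae_eq_zero]
  refine ae_of_all _ fun z => ?_
  refine measure_mono_null (t := {posSum z / r}) ?_ (by simp)
  rintro u ⟨hu, h⟩
  simp only [Set.mem_ofPred_eq, posSum_smul (inv_nonneg.2 hu.le)] at h
  rw [Set.mem_singleton_iff, ← h]
  have hz : posSum z ≠ 0 := by
    rintro h0
    rw [h0, mul_zero] at h
    exact hr.ne h
  field_simp

variable [NeZero d]

lemma exponentMeasure_polarSet (M : Measure (Fin d → ℝ)) {r : ℝ} (hr : 0 < r)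
    {B : Set (stdSimplex ℝ (Fin d))} (hB : MeasurableSet B) :
    exponentMeasure M (polarSet r B) =
      (∫⁻ z in simplexAngle ⁻¹' B, ENNReal.ofReal (posSum z) ∂M) / ENNReal.ofReal r := by
  have hG : Measurable fun z : Fin d → ℝ => ENNReal.ofReal (posSum z) / ENNReal.ofReal r :=
    (continuous_posSum.measurable.ennreal_ofReal).div_const _
  have h := exponentMeasure_inter_cone M hG (K := simplexAngle ⁻¹' B) ?_
    (measurable_simplexAngle hB) fun u hu z => ?_
  · rw [div_eq_mul_inv, ← lintegral_mul_const _ continuous_posSum.measurable.ennreal_ofReal]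
    rw [show polarSet r B = {x | 1 < ENNReal.ofReal (posSum x) / ENNReal.ofReal r} ∩
      simplexAngle ⁻¹' B from ?_, h]
    · rfl
    · ext x
      simp only [polarSet, Set.mem_ofPred_eq, Set.mem_inter_iff, Set.mem_preimage]
      refine and_congr_left fun _ => ?_
      rw [ENNReal.lt_div_iff_mul_lt (by simp [hr]) (by simp), one_mul,
        ENNReal.ofReal_lt_ofReal_iff_of_nonneg hr.le]
  · intro u hu z
    rw [posSum_smul (inv_nonneg.2 hu.le), ENNReal.ofReal_mul (inv_nonneg.2 hu.le),
      ENNReal.ofReal_inv_of_pos hu]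
    simp only [div_eq_mul_inv]
    ring
  · rw [Set.mem_preimage, simplexAngle_smul (inv_pos.2 hu)]
    rfl

end ExponentMeasure

/-! ### Generators of an exponent function -/

section Generator

variable {d : ℕ}

/-- The measure `M`, concentrated on the nonnegative orthant, represents the exponent function `V`
as `V y = ∫ maxᵢ (zᵢ / yᵢ) dM(z)`, and its marginals have mean one. The integrals are stated in
`[0, ∞]`, where the supremum over an empty index set is zero. -/
structure IsGenerator (M : Measure (Fin d → ℝ)) (V : (Fin d → ℝ) → ℝ) : Prop where
  ae_nonneg : ∀ᵐ z ∂M, ∀ i, 0 ≤ z i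
  lintegral_coord : ∀ i, ∫⁻ z, ENNReal.ofReal (z i) ∂M = 1
  lintegral_iSup : ∀ y : Fin d → ℝ, (∀ i, 0 < y i) →
    ∫⁻ z, ⨆ i, ENNReal.ofReal (z i / y i) ∂M = ENNReal.ofReal (V y)

variable {M : Measure (Fin d → ℝ)} {V : (Fin d → ℝ) → ℝ}

lemma measurableSet_nonneg : MeasurableSet {x : Fin d → ℝ | ∀ i, 0 ≤ x i} := by
  simp only [Set.ofPred_forall]
  exact MeasurableSet.iInter fun i => measurableSet_le measurable_const (measurable_pi_apply i)

lemma IsGenerator.ae_exponentMeasure_nonneg [SFinite M] (hM : IsGenerator M V) :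
    ∀ᵐ x ∂exponentMeasure M, ∀ i, 0 ≤ x i :=
  ae_exponentMeasure_of_cone (K := {x | ∀ i, 0 ≤ x i}) measurableSet_nonneg
    (fun _ hu _ hz i => mul_nonneg (inv_nonneg.2 hu.le) (hz i)) hM.ae_nonneg

lemma IsGenerator.exponentMeasure_compl_Iic (hM : IsGenerator M V) {y : Fin d → ℝ}
    (hy : ∀ i, 0 < y i) : exponentMeasure M (Set.Iic y)ᶜ = ENNReal.ofReal (V y) := by
  have h := exponentMeasure_inter_cone M (G := fun z => ⨆ i, ENNReal.ofReal (z i / y i))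
    (by fun_prop) ?_ (K := Set.univ) MeasurableSet.univ (fun _ _ _ => by simp)
  · rw [Set.inter_univ, Measure.restrict_univ, hM.lintegral_iSup y hy] at h
    rw [← h]
    congr 1
    ext x
    simp only [Set.mem_compl_iff, Set.mem_Iic, Pi.le_def, not_forall, not_le, Set.mem_ofPred_eq,
      lt_iSup_iff, ENNReal.one_lt_ofReal, one_lt_div (hy _)]
  · intro u hu z
    rw [ENNReal.div_eq_inv_mul, ENNReal.mul_iSup]
    refine iSup_congr fun i => ?_
    rw [← ENNReal.ofReal_inv_of_pos hu, ← ENNReal.ofReal_mul (inv_nonneg.2 hu.le)]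
    simp [mul_div_assoc]

lemma IsGenerator.inv_le (hM : IsGenerator M V) {y : Fin d → ℝ} (hy : ∀ i, 0 < y i)
    (i : Fin d) : (y i)⁻¹ ≤ V y := by
  have h : ENNReal.ofReal (y i)⁻¹ ≤ ENNReal.ofReal (V y) := by
    rw [← hM.lintegral_iSup y hy]
    calc ENNReal.ofReal (y i)⁻¹
        = ∫⁻ z, ENNReal.ofReal (z i) * ENNReal.ofReal (y i)⁻¹ ∂M := by
          rw [lintegral_mul_const _ (by fun_prop), hM.lintegral_coord, one_mul]
      _ ≤ ∫⁻ z, ⨆ i, ENNReal.ofReal (z i / y i) ∂M := by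
          refine lintegral_mono fun z => ?_
          rw [← ENNReal.ofReal_mul' (inv_nonneg.2 (hy i).le), ← div_eq_mul_inv]
          exact le_iSup (fun j => ENNReal.ofReal (z j / y j)) i
  by_contra! hlt
  exact absurd h (not_le.2 ((ENNReal.ofReal_lt_ofReal_iff (inv_pos.2 (hy i))).2 hlt))

lemma IsGenerator.pos [NeZero d] (hM : IsGenerator M V) {y : Fin d → ℝ} (hy : ∀ i, 0 < y i) :
    0 < V y :=
  (inv_pos.2 (hy 0)).trans_le (hM.inv_le hy 0)

lemma IsGenerator.smul [NeZero d] (hM : IsGenerator M V) {y : Fin d → ℝ} (hy : ∀ i, 0 < y i)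
    {t : ℝ} (ht : 0 < t) : V (t • y) = t⁻¹ * V y := by
  have hty : ∀ i, 0 < (t • y) i := fun i => mul_pos ht (hy i)
  have hV := hM.pos hy
  rw [← ENNReal.ofReal_eq_ofReal_iff (hM.pos hty).le (by positivity), ← hM.lintegral_iSup _ hty,
    ENNReal.ofReal_mul (inv_nonneg.2 ht.le), ← hM.lintegral_iSup _ hy,
    ← lintegral_const_mul _ (by fun_prop)]
  refine lintegral_congr fun z => ?_
  rw [ENNReal.mul_iSup]
  refine iSup_congr fun i => ?_
  rw [← ENNReal.ofReal_mul (inv_nonneg.2 ht.le)]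
  congr 1
  simp only [Pi.smul_apply, smul_eq_mul]
  field_simp

lemma IsGenerator.lintegral_posSum (hM : IsGenerator M V) :
    ∫⁻ z, ENNReal.ofReal (posSum z) ∂M = d := by
  simp only [ofReal_posSum]
  rw [lintegral_finsetSum _ fun i _ => by fun_prop]
  simp [hM.lintegral_coord]

/-- The angular measure of the exponent measure generated by `M`, normalized by the number of
coordinates: `B ↦ d⁻¹ ∫ ‖z‖₁ 1{z / ‖z‖₁ ∈ B} dM(z)`. -/
noncomputable def angularMeasure [NeZero d] (M : Measure (Fin d → ℝ)) :
    Measure (stdSimplex ℝ (Fin d)) :=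
  (d : ENNReal)⁻¹ • (M.withDensity fun z => ENNReal.ofReal (posSum z)).map simplexAngle

variable [NeZero d]

lemma angularMeasure_apply (M : Measure (Fin d → ℝ)) {B : Set (stdSimplex ℝ (Fin d))}
    (hB : MeasurableSet B) :
    angularMeasure M B =
      (d : ENNReal)⁻¹ * ∫⁻ z in simplexAngle ⁻¹' B, ENNReal.ofReal (posSum z) ∂M := by
  rw [angularMeasure, Measure.smul_apply, Measure.map_apply measurable_simplexAngle hB,
    withDensity_apply _ (measurable_simplexAngle hB), smul_eq_mul]

lemma natCast_ne_zero_ennreal : (d : ENNReal) ≠ 0 := by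
  exact_mod_cast NeZero.ne d

lemma IsGenerator.isProbabilityMeasure_angularMeasure (hM : IsGenerator M V) :
    IsProbabilityMeasure (angularMeasure M) := by
  constructor
  rw [angularMeasure_apply M MeasurableSet.univ, Set.preimage_univ, Measure.restrict_univ,
    hM.lintegral_posSum, ENNReal.inv_mul_cancel natCast_ne_zero_ennreal (by simp)]

lemma exponentMeasure_polarSet_eq_angularMeasure (M : Measure (Fin d → ℝ)) {r : ℝ} (hr : 0 < r)
    {B : Set (stdSimplex ℝ (Fin d))} (hB : MeasurableSet B) :
    exponentMeasure M (polarSet r B) = d * angularMeasure M B / ENNReal.ofReal r := by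
  rw [exponentMeasure_polarSet M hr hB, angularMeasure_apply M hB, ← mul_assoc,
    ENNReal.mul_inv_cancel natCast_ne_zero_ennreal (by simp), one_mul]

lemma exponentMeasure_frontier_polarSet [SFinite M] {r : ℝ} (hr : 0 < r)
    {B : Set (stdSimplex ℝ (Fin d))} (hB : angularMeasure M (frontier B) = 0) :
    exponentMeasure M (frontier (polarSet r B)) = 0 := by
  refine measure_mono_null (frontier_polarSet_subset hr B)
    (measure_union_null (exponentMeasure_posSum_eq M hr) ?_)
  have hm : MeasurableSet (simplexAngle ⁻¹' frontier B : Set (Fin d → ℝ)) :=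
    measurable_simplexAngle isClosed_frontier.measurableSet
  have h0 : MeasurableSet {x : Fin d → ℝ | 0 < posSum x} :=
    measurableSet_lt measurable_const continuous_posSum.measurable
  rw [angularMeasure_apply M isClosed_frontier.measurableSet, mul_eq_zero,
    or_iff_right (by simp), setLIntegral_eq_zero_iff hm
      continuous_posSum.measurable.ennreal_ofReal] at hB
  have := ae_exponentMeasure_of_cone (M := M)
    (K := {x : Fin d → ℝ | 0 < posSum x ∧ simplexAngle x ∈ frontier B}ᶜ) (h0.inter hm).compl ?_ ?_
  · simpa [ae_iff] using this
  · rintro u hu z hz ⟨h1, h2⟩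
    rw [posSum_smul (inv_nonneg.2 hu.le)] at h1
    rw [simplexAngle_smul (inv_pos.2 hu)] at h2
    exact hz ⟨pos_of_mul_pos_right h1 (inv_nonneg.2 hu.le), h2⟩
  · filter_upwards [hB] with z hz
    rintro ⟨h1, h2⟩
    simpa [h1.not_ge] using hz h2

end Generator

/-! ### Convergence of the rescaled vector far from the origin -/

section Convergence

variable {d : ℕ}

lemma cond_compl_Iic_real_Iic {μ : Measure (Fin d → ℝ)} {e y : Fin d → ℝ}
    (h : μ (Set.Iic (e ⊓ y))ᶜ ≠ ⊤) :
    (cond μ (Set.Iic e)ᶜ).real (Set.Iic y) =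
      (μ.real (Set.Iic (e ⊓ y))ᶜ - μ.real (Set.Iic y)ᶜ) / μ.real (Set.Iic e)ᶜ := by
  have hsub : (Set.Iic y)ᶜ ⊆ (Set.Iic (e ⊓ y))ᶜ :=
    Set.compl_subset_compl.2 (Set.Iic_subset_Iic.2 inf_le_right)
  have hset : (Set.Iic e)ᶜ ∩ Set.Iic y = (Set.Iic (e ⊓ y))ᶜ \ (Set.Iic y)ᶜ := by
    rw [← Set.Iic_inter_Iic, Set.compl_inter, Set.union_sdiff_right, Set.sdiff_compl]
  rw [← measureReal_sdiff hsub measurableSet_Iic.compl h, measureReal_def,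
    cond_apply measurableSet_Iic.compl, ENNReal.toReal_mul, ENNReal.toReal_inv, div_eq_inv_mul,
    hset]
  rfl

lemma tendsto_mul_one_sub_exp (a : ℝ) :
    Tendsto (fun t : ℝ => t * (1 - Real.exp (-(t⁻¹ * a)))) atTop (𝓝 a) := by
  have h : HasDerivAt (fun u : ℝ => -Real.exp (-(u * a))) a 0 := by
    have := (((hasDerivAt_id (0 : ℝ)).mul_const a).neg.exp).neg
    refine this.congr_deriv ?_
    simp
  have := h.tendsto_slope_zero_right.comp tendsto_inv_atTop_nhdsGT_zero
  refine this.congr fun t => ?_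
  simp only [Function.comp_apply, inv_inv, zero_add, zero_mul, neg_zero, Real.exp_zero, smul_eq_mul]
  ring

variable {Ω : Type*} [MeasurableSpace Ω] {P : Measure Ω} [IsProbabilityMeasure P]
  {X : Ω → Fin d → ℝ} {M : Measure (Fin d → ℝ)} {V : (Fin d → ℝ) → ℝ}

lemma IsGenerator.ae_nonneg_of_cdf (hM : IsGenerator M V)
    (hcdf : ∀ x : Fin d → ℝ, (∀ i, 0 < x i) →
      P.real {ω | ∀ i, X ω i ≤ x i} = Real.exp (-V x)) :
    ∀ᵐ ω ∂P, ∀ i, 0 ≤ X ω i := by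
  rw [ae_all_iff]
  intro i
  have hsub : {ω | ¬ 0 ≤ X ω i} ⊆ ⋃ n : ℕ, {ω | X ω i < 0 ∧ ∀ j, X ω j ≤ (n : ℝ) + 1} := by
    intro ω hω
    obtain ⟨n, hn⟩ := exists_nat_ge (∑ j, |X ω j|)
    refine Set.mem_iUnion.2 ⟨n, not_le.1 hω, fun j => ?_⟩
    have h1 : |X ω j| ≤ ∑ j, |X ω j| := Finset.single_le_sum (f := fun j => |X ω j|)
      (fun _ _ => abs_nonneg _) (Finset.mem_univ j)
    linarith [le_abs_self (X ω j)]
  refine measure_mono_null hsub (measure_iUnion_null fun n => ?_)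
  have hle : ∀ m : ℕ, P.real {ω | X ω i < 0 ∧ ∀ j, X ω j ≤ (n : ℝ) + 1} ≤
      Real.exp (-((m : ℝ) + 1)) := by
    intro m
    set x : Fin d → ℝ := Function.update (fun _ => (n : ℝ) + 1) i ((m : ℝ) + 1)⁻¹ with hx
    have hx0 : ∀ j, 0 < x j := by
      intro j
      rcases eq_or_ne j i with rfl | hj
      · simp only [hx, Function.update_self]
        positivity
      · simp only [hx, Function.update_of_ne hj]
        positivity
    have hV := hM.inv_le hx0 i
    simp only [hx, Function.update_self, inv_inv] at hV
    refine (measureReal_mono (s₂ := {ω | ∀ j, X ω j ≤ x j}) ?_).trans ?_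
    · rintro ω ⟨h0, h⟩ j
      rcases eq_or_ne j i with rfl | hj
      · exact h0.le.trans (hx0 j).le
      · simpa [hx, hj] using h j
    · rw [hcdf x hx0]
      exact Real.exp_le_exp.2 (neg_le_neg hV)
  have hlim : Tendsto (fun m : ℕ => Real.exp (-((m : ℝ) + 1))) atTop (𝓝 0) :=
    Real.tendsto_exp_neg_atTop_nhds_zero.comp
      (tendsto_atTop_add_const_right _ _ tendsto_natCast_atTop_atTop)
  have := ge_of_tendsto' hlim hle
  rw [← measureReal_eq_zero_iff]
  exact le_antisymm this measureReal_nonneg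

variable [NeZero d]

lemma IsGenerator.map_compl_Iic (hM : IsGenerator M V) (hX : Measurable X)
    (hcdf : ∀ x : Fin d → ℝ, (∀ i, 0 < x i) →
      P.real {ω | ∀ i, X ω i ≤ x i} = Real.exp (-V x))
    {t : ℝ} (ht : 0 < t) {y : Fin d → ℝ} (hy : ∀ i, 0 < y i) :
    (P.map fun ω => t⁻¹ • X ω).real (Set.Iic y)ᶜ = 1 - Real.exp (-(t⁻¹ * V y)) := by
  have hm : Measurable fun ω => t⁻¹ • X ω := hX.const_smul t⁻¹
  have := Measure.isProbabilityMeasure_map (μ := P) hm.aemeasurable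
  rw [probReal_compl_eq_one_sub measurableSet_Iic, map_measureReal_apply hm measurableSet_Iic,
    ← hM.smul hy ht, ← hcdf (t • y) fun i => mul_pos ht (hy i)]
  congr 3
  ext ω
  simp only [Set.mem_preimage, Set.mem_Iic, Pi.le_def, Pi.smul_apply, smul_eq_mul,
    Set.mem_ofPred_eq, inv_mul_le_iff₀ ht]

/-- Conditionally on `X / t` lying outside the orthant below `e`, its distribution function converges
to that of the correspondingly conditioned exponent measure. Points with a zero coordinate are
excluded, since the exponent measure charges the faces of the nonnegative orthant. -/
lemma IsGenerator.tendsto_cond_real_Iic [SFinite M] (hM : IsGenerator M V) (hX : Measurable X)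
    (hcdf : ∀ x : Fin d → ℝ, (∀ i, 0 < x i) →
      P.real {ω | ∀ i, X ω i ≤ x i} = Real.exp (-V x))
    {e : Fin d → ℝ} (he : ∀ i, 0 < e i) {y : Fin d → ℝ} (hy : ∀ i, y i ≠ 0) :
    Tendsto (fun t : ℝ => (cond (P.map fun ω => t⁻¹ • X ω) (Set.Iic e)ᶜ).real (Set.Iic y)) atTop
      (𝓝 ((cond (exponentMeasure M) (Set.Iic e)ᶜ).real (Set.Iic y))) := by
  by_cases hpos : ∀ i, 0 < y i
  · have hey : ∀ i, 0 < (e ⊓ y) i := fun i => lt_min (he i) (hpos i)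
    have hreal : ∀ z : Fin d → ℝ, (∀ i, 0 < z i) →
        (exponentMeasure M).real (Set.Iic z)ᶜ = V z := fun z hz => by
      rw [measureReal_def, hM.exponentMeasure_compl_Iic hz, ENNReal.toReal_ofReal (hM.pos hz).le]
    rw [cond_compl_Iic_real_Iic (by simp [hM.exponentMeasure_compl_Iic hey]), hreal _ hey,
      hreal _ hpos, hreal _ he]
    have hlim := ((tendsto_mul_one_sub_exp (V (e ⊓ y))).sub (tendsto_mul_one_sub_exp (V y))).div
      (tendsto_mul_one_sub_exp (V e)) (hM.pos he).ne'
    refine hlim.congr' ?_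
    filter_upwards [eventually_gt_atTop 0] with t ht
    have hm : Measurable fun ω => t⁻¹ • X ω := hX.const_smul t⁻¹
    have := Measure.isProbabilityMeasure_map (μ := P) hm.aemeasurable
    rw [cond_compl_Iic_real_Iic (measure_ne_top _ _), hM.map_compl_Iic hX hcdf ht hey,
      hM.map_compl_Iic hX hcdf ht hpos, hM.map_compl_Iic hX hcdf ht he]
    simp only [Pi.div_apply]
    rw [← mul_sub, mul_div_mul_left _ _ ht.ne']
  · push Not at hpos
    obtain ⟨i, hi⟩ := hpos
    have hi' : y i < 0 := lt_of_le_of_ne hi (hy i)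
    have key : ∀ μ : Measure (Fin d → ℝ), (∀ᵐ x ∂μ, ∀ i, 0 ≤ x i) →
        (cond μ (Set.Iic e)ᶜ).real (Set.Iic y) = 0 := by
      intro μ hμ
      rw [measureReal_def, ENNReal.toReal_eq_zero_iff]
      refine Or.inl ?_
      have h := (cond_absolutelyContinuous (μ := μ) (s := (Set.Iic e)ᶜ)).ae_le hμ
      refine measure_mono_null ?_ h
      intro x hx h0
      exact absurd ((h0 i).trans (hx i)) (not_le.2 hi')
    rw [key _ hM.ae_exponentMeasure_nonneg]
    refine tendsto_const_nhds.congr' ?_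
    filter_upwards [eventually_gt_atTop 0] with t ht
    refine (key _ ?_).symm
    have hm : Measurable fun ω => t⁻¹ • X ω := hX.const_smul t⁻¹
    rw [ae_map_iff hm.aemeasurable measurableSet_nonneg]
    filter_upwards [hM.ae_nonneg_of_cdf hcdf] with ω hω i
    exact mul_nonneg (inv_nonneg.2 ht.le) (hω i)

end Convergence

/-! ### Existence and uniqueness of the spectral measure -/

section Spectral

variable {d : ℕ} [NeZero d] {Ω : Type*} [MeasurableSpace Ω] {P : Measure Ω}
  [IsProbabilityMeasure P] {X : Ω → Fin d → ℝ} {M : Measure (Fin d → ℝ)}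
  {V : (Fin d → ℝ) → ℝ}

lemma polarSet_subset_compl_Iic {r : ℝ} (hr : 1 ≤ r) (B : Set (stdSimplex ℝ (Fin d))) :
    polarSet r B ⊆ (Set.Iic fun _ : Fin d => (d : ℝ)⁻¹)ᶜ := by
  rintro x ⟨hx, -⟩ hle
  have hd : (0 : ℝ) < d := by exact_mod_cast NeZero.pos d
  have : posSum x ≤ ∑ _i : Fin d, (d : ℝ)⁻¹ :=
    Finset.sum_le_sum fun i _ => max_le (hle i) (inv_nonneg.2 hd.le)
  rw [Finset.sum_const, Finset.card_univ, Fintype.card_fin, nsmul_eq_mul,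
    mul_inv_cancel₀ hd.ne'] at this
  linarith

omit [MeasurableSpace Ω] in
lemma inv_smul_mem_polarSet_iff {t r : ℝ} (ht : 0 < t) (hr : 0 < r)
    (B : Set (stdSimplex ℝ (Fin d))) {ω : Ω} (hω : ∀ i, 0 ≤ X ω i) :
    t⁻¹ • X ω ∈ polarSet r B ↔ t * r < radius X ω ∧ angle X ω ∈ Subtype.val '' B := by
  have hrad : posSum (X ω) = radius X ω := posSum_eq_sum hω
  rw [polarSet, Set.mem_ofPred_eq, posSum_smul (inv_nonneg.2 ht.le),
    simplexAngle_smul (inv_pos.2 ht), hrad, lt_inv_mul_iff₀ ht]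
  refine and_congr_right fun h => ?_
  have h0 : 0 < posSum (X ω) := hrad ▸ (mul_pos ht hr).trans h
  have hang : (simplexAngle (X ω)).1 = angle X ω := by
    refine (coe_simplexAngle h0).trans (funext fun i => ?_)
    rw [max_eq_left (hω i), hrad]
    rfl
  rw [← hang, Subtype.val_injective.mem_set_image]

lemma cond_real_of_subset {α : Type*} [MeasurableSpace α] {μ : Measure α} {A E : Set α}
    (hE : MeasurableSet E) (h : A ⊆ E) : (cond μ E).real A = μ.real A / μ.real E := by
  rw [measureReal_def, cond_apply hE, Set.inter_eq_self_of_subset_right h, ENNReal.toReal_mul,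
    ENNReal.toReal_inv, div_eq_inv_mul]
  rfl

/-- The masses of sets in polar coordinates, for `X / t` conditioned on one coordinate exceeding
`1 / d`, converge when the boundary angles carry no mass. -/
lemma IsGenerator.tendsto_cond_polarSet [IsFiniteMeasure M] (hM : IsGenerator M V)
    (hX : Measurable X)
    (hcdf : ∀ x : Fin d → ℝ, (∀ i, 0 < x i) →
      P.real {ω | ∀ i, X ω i ≤ x i} = Real.exp (-V x))
    {r : ℝ} (hr : 1 ≤ r) {B : Set (stdSimplex ℝ (Fin d))}
    (hB : angularMeasure M (frontier B) = 0) :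
    Tendsto (fun t : ℝ => (cond (P.map fun ω => t⁻¹ • X ω)
        (Set.Iic fun _ : Fin d => (d : ℝ)⁻¹)ᶜ).real (polarSet r B)) atTop
      (𝓝 ((cond (exponentMeasure M) (Set.Iic fun _ : Fin d => (d : ℝ)⁻¹)ᶜ).real
        (polarSet r B))) := by
  have hd : (0 : ℝ) < d := by exact_mod_cast NeZero.pos d
  have he : ∀ _i : Fin d, 0 < (d : ℝ)⁻¹ := fun _ => inv_pos.2 hd
  have hE : exponentMeasure M (Set.Iic fun _ : Fin d => (d : ℝ)⁻¹)ᶜ =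
      ENNReal.ofReal (V fun _ => (d : ℝ)⁻¹) := hM.exponentMeasure_compl_Iic he
  have hνp : IsProbabilityMeasure
      (cond (exponentMeasure M) (Set.Iic fun _ : Fin d => (d : ℝ)⁻¹)ᶜ) := by
    refine cond_isProbabilityMeasure_of_finite ?_ ?_
    · simp [hE, hM.pos he]
    · simp [hE]
  -- The conditional law need not be a probability measure for `t ≤ 0`, hence `max t 1`.
  have hμp : ∀ t : ℝ, IsProbabilityMeasure (cond (P.map fun ω => (max t 1)⁻¹ • X ω)
      (Set.Iic fun _ : Fin d => (d : ℝ)⁻¹)ᶜ) := by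
    intro t
    have ht : 0 < max t 1 := lt_max_of_lt_right one_pos
    have hm : Measurable fun ω => (max t 1)⁻¹ • X ω := hX.const_smul (max t 1)⁻¹
    have := Measure.isProbabilityMeasure_map (μ := P) hm.aemeasurable
    refine cond_isProbabilityMeasure ?_
    rw [← measureReal_ne_zero_iff, hM.map_compl_Iic hX hcdf ht he]
    have : Real.exp (-((max t 1)⁻¹ * V fun _ => (d : ℝ)⁻¹)) < 1 :=
      Real.exp_lt_one_iff.2 (neg_neg_of_pos (mul_pos (inv_pos.2 ht) (hM.pos he)))
    linarith
  have hev : ∀ᶠ t : ℝ in atTop, max t 1 = t := by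
    filter_upwards [eventually_ge_atTop 1] with t ht using max_eq_left ht
  have hweak : Tendsto (β := ProbabilityMeasure (Fin d → ℝ)) (fun t : ℝ => ⟨_, hμp t⟩) atTop
      (𝓝 ⟨_, hνp⟩) := by
    refine tendsto_probabilityMeasure_of_tendsto_Iic (s := {0}ᶜ) (dense_compl_singleton 0)
      fun y hy => ?_
    refine (hM.tendsto_cond_real_Iic hX hcdf he hy).congr' ?_
    filter_upwards [hev] with t ht
    simp only [ProbabilityMeasure.coe_mk, ht]
  have hfr : cond (exponentMeasure M) (Set.Iic fun _ : Fin d => (d : ℝ)⁻¹)ᶜ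
      (frontier (polarSet r B)) = 0 :=
    cond_absolutelyContinuous (exponentMeasure_frontier_polarSet (one_pos.trans_le hr) hB)
  have h := (ENNReal.tendsto_toReal (measure_ne_top
    (cond (exponentMeasure M) (Set.Iic fun _ : Fin d => (d : ℝ)⁻¹)ᶜ) _)).comp
    (ProbabilityMeasure.tendsto_measure_of_null_frontier_of_tendsto' hweak hfr)
  refine h.congr' ?_
  filter_upwards [hev] with t ht
  simp only [Function.comp_apply, ProbabilityMeasure.coe_mk, ht]
  rfl

/-- The angular measure of the generator of the exponent function is a spectral measure. -/
theorem IsGenerator.isSpectralMeasure [IsFiniteMeasure M] (hM : IsGenerator M V)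
    (hX : Measurable X)
    (hcdf : ∀ x : Fin d → ℝ, (∀ i, 0 < x i) →
      P.real {ω | ∀ i, X ω i ≤ x i} = Real.exp (-V x)) :
    IsSpectralMeasure P X (angularMeasure M) := by
  have hprob := hM.isProbabilityMeasure_angularMeasure
  refine ⟨hprob, fun B hBm hB r hr => ?_⟩
  have hr0 : 0 < r := one_pos.trans_le hr
  have hd : (0 : ℝ) < d := by exact_mod_cast NeZero.pos d
  have he : ∀ _i : Fin d, 0 < (d : ℝ)⁻¹ := fun _ => inv_pos.2 hd
  set E : Set (Fin d → ℝ) := (Set.Iic fun _ : Fin d => (d : ℝ)⁻¹)ᶜ with hEdef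
  have hEm : MeasurableSet E := measurableSet_Iic.compl
  have hE : (exponentMeasure M).real E = V fun _ => (d : ℝ)⁻¹ := by
    rw [measureReal_def, hEdef, hM.exponentMeasure_compl_Iic he,
      ENNReal.toReal_ofReal (hM.pos he).le]
  have hreal : ∀ r' : ℝ, 0 < r' → ∀ B' : Set (stdSimplex ℝ (Fin d)), MeasurableSet B' →
      (exponentMeasure M).real (polarSet r' B') = d * (angularMeasure M).real B' / r' := by
    intro r' hr' B' hB'
    rw [measureReal_def, exponentMeasure_polarSet_eq_angularMeasure M hr' hB', ENNReal.toReal_div,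
      ENNReal.toReal_mul, ENNReal.toReal_ofReal hr'.le]
    simp [measureReal_def]
  have hnum := hM.tendsto_cond_polarSet hX hcdf hr hB
  have hden := hM.tendsto_cond_polarSet hX hcdf le_rfl (B := Set.univ) (by simp)
  rw [cond_real_of_subset hEm (polarSet_subset_compl_Iic hr B), hreal r hr0 B hBm, hE] at hnum
  rw [cond_real_of_subset hEm (polarSet_subset_compl_Iic le_rfl _),
    hreal 1 one_pos _ MeasurableSet.univ, hE, probReal_univ] at hden
  have hV := hM.pos he
  have hlim := hnum.div hden (by positivity)
  have hval : d * (angularMeasure M).real B / r / (V fun _ => (d : ℝ)⁻¹) /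
      (d * 1 / 1 / V fun _ => (d : ℝ)⁻¹) = (angularMeasure M).real B * r⁻¹ := by
    generalize (V fun _ => (d : ℝ)⁻¹) = v at hV
    field_simp
  rw [hval] at hlim
  refine hlim.congr' ?_
  filter_upwards [eventually_gt_atTop 0] with t ht
  have hm : Measurable fun ω => t⁻¹ • X ω := hX.const_smul t⁻¹
  have hrad : Measurable (radius X) := by
    unfold radius
    fun_prop
  have hnn := hM.ae_nonneg_of_cdf hcdf
  have hE0 : (P.map fun ω => t⁻¹ • X ω).real E ≠ 0 := by
    rw [hEdef, hM.map_compl_Iic hX hcdf ht he]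
    have : Real.exp (-(t⁻¹ * V fun _ => (d : ℝ)⁻¹)) < 1 :=
      Real.exp_lt_one_iff.2 (neg_neg_of_pos (mul_pos (inv_pos.2 ht) (hM.pos he)))
    linarith
  have hdenset : P.real ((fun ω => t⁻¹ • X ω) ⁻¹' polarSet 1 Set.univ) =
      P.real {ω | t < radius X ω} := by
    refine measureReal_congr ?_
    filter_upwards [hnn] with ω hω
    refine propext ((inv_smul_mem_polarSet_iff ht one_pos _ hω).trans ?_)
    rw [mul_one]
    refine and_iff_left_of_imp fun hlt => ?_
    have := ((inv_smul_mem_polarSet_iff ht one_pos Set.univ hω).1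
      ⟨?_, Set.mem_univ _⟩).2
    · exact this
    · rwa [posSum_smul (inv_nonneg.2 ht.le), lt_inv_mul_iff₀ ht, mul_one, posSum_eq_sum hω]
  have hnumset : P.real ((fun ω => t⁻¹ • X ω) ⁻¹' polarSet r B) =
      P.real ({ω | t < radius X ω} ∩
        {ω | t * r < radius X ω ∧ angle X ω ∈ Subtype.val '' B}) := by
    refine measureReal_congr ?_
    filter_upwards [hnn] with ω hω
    refine propext ((inv_smul_mem_polarSet_iff ht hr0 _ hω).trans ?_)
    refine (and_iff_right_of_imp fun h => ?_).symm
    exact (le_mul_of_one_le_right ht.le hr).trans_lt h.1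
  simp only [Pi.div_apply]
  rw [cond_real_of_subset hEm (polarSet_subset_compl_Iic hr B),
    cond_real_of_subset hEm (polarSet_subset_compl_Iic le_rfl _),
    div_div_div_cancel_right₀ hE0, map_measureReal_apply hm (measurableSet_polarSet _ hBm),
    map_measureReal_apply hm (measurableSet_polarSet _ MeasurableSet.univ), hnumset, hdenset,
    measureReal_def (cond _ _), cond_apply (measurableSet_lt measurable_const hrad),
    ENNReal.toReal_mul, ENNReal.toReal_inv, div_eq_inv_mul]
  rfl

omit [NeZero d] [IsProbabilityMeasure P] in
/-- Two spectral measures agree on all sets that are null-boundary sets of both, hence on small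
thickenings of closed sets, hence on closed sets. -/
theorem IsSpectralMeasure.unique {H H' : Measure (stdSimplex ℝ (Fin d))}
    (h : IsSpectralMeasure P X H) (h' : IsSpectralMeasure P X H') : H = H' := by
  have := h.isProbabilityMeasure
  have := h'.isProbabilityMeasure
  have hnull : ∀ B : Set (stdSimplex ℝ (Fin d)), MeasurableSet B → H (frontier B) = 0 →
      H' (frontier B) = 0 → H B = H' B := by
    intro B hB h1 h2
    have := tendsto_nhds_unique (h.tendsto B hB h1 1 le_rfl) (h'.tendsto B hB h2 1 le_rfl)
    rw [inv_one, mul_one, mul_one, measureReal_eq_measureReal_iff] at this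
    exact this
  refine ext_of_generate_finite {F | IsClosed F}
    (BorelSpace.measurable_eq.trans borel_eq_generateFrom_isClosed) isPiSystem_isClosed
    (fun F hF => ?_) (by simp)
  obtain ⟨rs, hrs, hrs'⟩ := exists_null_frontiers_thickening (H + H') F
  have hrs0 : Tendsto rs atTop (𝓝[>] 0) :=
    tendsto_nhdsWithin_iff.2 ⟨hrs, Eventually.of_forall fun n => (hrs' n).1⟩
  have t1 := (tendsto_measure_thickening_of_isClosed (μ := H) ⟨1, one_pos, measure_ne_top _ _⟩
    hF).comp hrs0
  have t2 := (tendsto_measure_thickening_of_isClosed (μ := H') ⟨1, one_pos, measure_ne_top _ _⟩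
    hF).comp hrs0
  refine tendsto_nhds_unique t1 (t2.congr fun n => ?_)
  have hn := (hrs' n).2
  rw [Measure.add_apply, add_eq_zero] at hn
  exact (hnull _ Metric.isOpen_thickening.measurableSet hn.1 hn.2).symm

end Spectral

/-! ### Maxima of independent Fréchet variables -/

section Frechet

/-- The Fréchet distribution with shape `1 / α`, the law of `E ^ (-α)` for a standard exponential
variable `E`. -/
noncomputable def frechet (α : ℝ) : Measure ℝ := (expMeasure 1).map fun e => e ^ (-α)

/-- The mean of the Fréchet distribution with shape `1 / α`. -/
noncomputable def frechetMean (α : ℝ) : ENNReal := ∫⁻ y, ENNReal.ofReal y ∂frechet α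

lemma measurable_rpow_neg (α : ℝ) : Measurable fun e : ℝ => e ^ (-α) := by
  fun_prop

lemma ae_expMeasure_pos : ∀ᵐ e ∂expMeasure 1, 0 < e := by
  have := isProbabilityMeasure_expMeasure one_pos
  have h := cdf_expMeasure_eq one_pos 0
  rw [cdf_eq_real] at h
  simp only [le_refl, if_true, mul_zero, neg_zero, Real.exp_zero, sub_self] at h
  rw [measureReal_eq_zero_iff] at h
  rw [ae_iff]
  simp only [not_lt]
  exact h

lemma expMeasure_Ioi {b : ℝ} (hb : 0 ≤ b) :
    expMeasure 1 (Set.Ioi b) = ENNReal.ofReal (Real.exp (-b)) := by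
  have := isProbabilityMeasure_expMeasure one_pos
  have h := cdf_expMeasure_eq one_pos b
  rw [cdf_eq_real, if_pos hb, one_mul] at h
  rw [← ofReal_measureReal, ← Set.compl_Iic, probReal_compl_eq_one_sub measurableSet_Iic, h,
    sub_sub_cancel]

instance isProbabilityMeasure_frechet (α : ℝ) : IsProbabilityMeasure (frechet α) := by
  have := isProbabilityMeasure_expMeasure one_pos
  exact Measure.isProbabilityMeasure_map (measurable_rpow_neg α).aemeasurable

lemma ae_frechet_pos (α : ℝ) : ∀ᵐ y ∂frechet α, 0 < y := by
  rw [frechet, ae_map_iff (measurable_rpow_neg α).aemeasurable measurableSet_Ioi]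
  filter_upwards [ae_expMeasure_pos] with e he using Real.rpow_pos_of_pos he _

lemma frechet_Iio {α : ℝ} (hα : 0 < α) {y : ℝ} (hy : 0 < y) :
    frechet α (Set.Iio y) = ENNReal.ofReal (Real.exp (-y ^ (-α)⁻¹)) := by
  rw [frechet, Measure.map_apply (measurable_rpow_neg α) measurableSet_Iio,
    ← expMeasure_Ioi (Real.rpow_nonneg hy.le _)]
  refine measure_congr ?_
  filter_upwards [ae_expMeasure_pos] with e he
  exact propext (Real.rpow_inv_lt_iff_of_neg hy he (neg_neg_of_pos hα)).symm

lemma frechet_mul_lt {α : ℝ} (hα : 0 < α) {c u : ℝ} (hc : 0 ≤ c) (hu : 0 < u) :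
    frechet α {y | c * y < u} = ENNReal.ofReal (Real.exp (-(c / u) ^ (1 / α))) := by
  rcases hc.eq_or_lt with rfl | hc
  · have : {y : ℝ | 0 * y < u} = Set.univ := by
      ext y
      simpa using hu
    rw [this, measure_univ, zero_div, Real.zero_rpow (by positivity)]
    simp
  · have : {y : ℝ | c * y < u} = Set.Iio (u / c) := by
      ext y
      simp [lt_div_iff₀' hc]
    rw [this, frechet_Iio hα (by positivity), inv_neg, Real.rpow_neg (by positivity),
      ← Real.inv_rpow (by positivity), inv_div, one_div]

lemma lintegral_ofReal_eq_of_measure_lt_eq {β γ : Type*} [MeasurableSpace β] [MeasurableSpace γ]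
    {μ : Measure β} {ν : Measure γ} [IsProbabilityMeasure μ] [IsProbabilityMeasure ν]
    {f : β → ℝ} {g : γ → ℝ} (hf : Measurable f) (hg : Measurable g)
    (hf0 : 0 ≤ᵐ[μ] f) (hg0 : 0 ≤ᵐ[ν] g)
    (h : ∀ u : ℝ, 0 < u → μ {x | f x < u} = ν {x | g x < u}) :
    ∫⁻ x, ENNReal.ofReal (f x) ∂μ = ∫⁻ x, ENNReal.ofReal (g x) ∂ν := by
  rw [lintegral_eq_lintegral_meas_le μ hf0 hf.aemeasurable,
    lintegral_eq_lintegral_meas_le ν hg0 hg.aemeasurable]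
  refine setLIntegral_congr_fun measurableSet_Ioi fun u hu => ?_
  have e1 : {x | u ≤ f x} = {x | f x < u}ᶜ := by
    ext x
    simp
  have e2 : {x | u ≤ g x} = {x | g x < u}ᶜ := by
    ext x
    simp
  simp only [e1, e2]
  rw [prob_compl_eq_one_sub (measurableSet_lt hf measurable_const),
    prob_compl_eq_one_sub (measurableSet_lt hg measurable_const), h u hu]

/-- Max-stability: the weighted maximum of independent Fréchet variables has the law of a single
Fréchet variable multiplied by the `ℓ^(1/α)`-norm of the weights, hence the stated mean. -/
lemma lintegral_iSup_frechet {κ : Type*} [Fintype κ] {α : ℝ} (hα : 0 < α) {c : κ → ℝ}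
    (hc : ∀ i, 0 ≤ c i) :
    ∫⁻ y : κ → ℝ, ⨆ i, ENNReal.ofReal (c i * y i) ∂Measure.pi (fun _ => frechet α) =
      ENNReal.ofReal ((∑ i, c i ^ (1 / α)) ^ α) * frechetMean α := by
  have hs : 0 ≤ ∑ i, c i ^ (1 / α) := Finset.sum_nonneg fun i _ => Real.rpow_nonneg (hc i) _
  have hsα : 0 ≤ (∑ i, c i ^ (1 / α)) ^ α := Real.rpow_nonneg hs _
  have hsup : Measurable fun y : κ → ℝ => ⨆ i, ENNReal.ofReal (c i * y i) := by fun_prop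
  have hfin : ∀ y : κ → ℝ, ⨆ i, ENNReal.ofReal (c i * y i) < ⊤ := fun y => by
    rw [← Finset.sup_univ_eq_iSup, Finset.sup_lt_iff (by simp)]
    simp
  rw [frechetMean, ← lintegral_const_mul _ (by fun_prop)]
  simp only [← ENNReal.ofReal_mul hsα]
  have e : ∀ y : κ → ℝ, ⨆ i, ENNReal.ofReal (c i * y i) =
      ENNReal.ofReal (⨆ i, ENNReal.ofReal (c i * y i)).toReal := fun y =>
    (ENNReal.ofReal_toReal (hfin y).ne).symm
  rw [lintegral_congr e]
  refine lintegral_ofReal_eq_of_measure_lt_eq hsup.ennreal_toReal (by fun_prop)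
    (ae_of_all _ fun _ => ENNReal.toReal_nonneg) ?_ fun u hu => ?_
  · filter_upwards [ae_frechet_pos α] with y hy using mul_nonneg hsα hy.le
  · have hset : {y : κ → ℝ | (⨆ i, ENNReal.ofReal (c i * y i)).toReal < u} =
        Set.univ.pi fun i => {t | c i * t < u} := by
      ext y
      rw [Set.mem_ofPred_eq, ← ENNReal.lt_ofReal_iff_toReal_lt (hfin y).ne,
        ← Finset.sup_univ_eq_iSup, Finset.sup_lt_iff (by simpa using hu)]
      simp [Set.mem_pi, ENNReal.ofReal_lt_ofReal_iff hu]
    rw [hset, Measure.pi_pi, frechet_mul_lt hα hsα hu]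
    simp only [frechet_mul_lt hα (hc _) hu]
    rw [← ENNReal.ofReal_prod_of_nonneg fun _ _ => (Real.exp_pos _).le, ← Real.exp_sum,
      Finset.sum_neg_distrib]
    congr 3
    rw [Real.div_rpow hsα hu.le, ← Real.rpow_mul hs, mul_one_div_cancel hα.ne', Real.rpow_one,
      Finset.sum_div]
    exact Finset.sum_congr rfl fun i _ => Real.div_rpow (hc i) hu.le _

lemma frechetMean_ne_zero (α : ℝ) : frechetMean α ≠ 0 := by
  rw [frechetMean, Ne, lintegral_eq_zero_iff (by fun_prop)]
  intro h
  have : ∀ᵐ _y ∂frechet α, False := by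
    filter_upwards [h, ae_frechet_pos α] with y h1 h2
    simp [h2.not_ge] at h1
  exact IsProbabilityMeasure.ne_zero (frechet α) (by simpa using this)

lemma frechetMean_ne_top {α : ℝ} (hα : α < 1) : frechetMean α ≠ ⊤ := by
  have hint := Real.GammaIntegral_convergent (s := 1 - α) (by linarith)
  rw [frechetMean, frechet, lintegral_map (by fun_prop) (measurable_rpow_neg α),
    ← Measure.restrict_eq_self_of_ae_mem ae_expMeasure_pos]
  have hd : expMeasure 1 = volume.withDensity (exponentialPDF 1) := rfl
  have hm : Measurable (exponentialPDF 1) := (measurable_exponentialPDFReal 1).ennreal_ofReal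
  change ∫⁻ e in Set.Ioi 0, ENNReal.ofReal (e ^ (-α)) ∂expMeasure 1 ≠ ⊤
  rw [hd, restrict_withDensity measurableSet_Ioi,
    lintegral_withDensity_eq_lintegral_mul _ hm (by fun_prop)]
  have : ∀ e ∈ Set.Ioi (0 : ℝ), (exponentialPDF 1 * fun e => ENNReal.ofReal (e ^ (-α))) e =
      ENNReal.ofReal (Real.exp (-e) * e ^ (1 - α - 1)) := by
    intro e he
    rw [Pi.mul_apply, exponentialPDF_of_nonneg (le_of_lt he), one_mul, one_mul,
      ← ENNReal.ofReal_mul (Real.exp_pos _).le, show 1 - α - 1 = -α by ring]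
  rw [setLIntegral_congr_fun measurableSet_Ioi this]
  exact hint.lintegral_lt_top.ne

end Frechet

/-! ### The generator of the asymmetric logistic model -/

section AsymmetricLogistic

variable {d : ℕ}

/-- The vector of independent coordinates `y` with weights `θ i C`, scaled by the inverse of the
Fréchet mean. -/
noncomputable def weighted (α : ℝ) (θ : Fin d → Finset (Fin d) → ℝ) (C : Finset (Fin d))
    (y : Fin d → ℝ) : Fin d → ℝ :=
  fun i => (frechetMean α).toReal⁻¹ * (θ i C * y i)

/-- The generator of the asymmetric logistic model: the sum over all non-empty `C` of the laws of
the vectors `(θ i C * Y i)ᵢ`, where the `Y i` are independent Fréchet variables normalized to have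
mean one. -/
noncomputable def generator (α : ℝ) (θ : Fin d → Finset (Fin d) → ℝ) : Measure (Fin d → ℝ) :=
  ∑ C ∈ (Finset.univ : Finset (Finset (Fin d))).filter (fun C => C.Nonempty),
    (Measure.pi fun _ => frechet α).map (weighted α θ C)

variable {α : ℝ} {θ : Fin d → Finset (Fin d) → ℝ}

lemma measurable_weighted (C : Finset (Fin d)) : Measurable (weighted α θ C) := by
  unfold weighted
  fun_prop

instance isFiniteMeasure_generator : IsFiniteMeasure (generator α θ) := by
  unfold generator
  infer_instance

lemma lintegral_generator {f : (Fin d → ℝ) → ENNReal} (hf : Measurable f) :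
    ∫⁻ z, f z ∂generator α θ =
      ∑ C ∈ (Finset.univ : Finset (Finset (Fin d))).filter (fun C => C.Nonempty),
        ∫⁻ y, f (weighted α θ C y) ∂Measure.pi fun _ => frechet α := by
  rw [generator, lintegral_finsetSum_measure]
  exact Finset.sum_congr rfl fun C _ => lintegral_map hf (measurable_weighted C)

lemma ae_pi_frechet_pos : ∀ᵐ y : Fin d → ℝ ∂Measure.pi (fun _ => frechet α), ∀ i, 0 < y i :=
  eventually_all.2 fun _ => Measure.tendsto_eval_ae_ae.eventually (ae_frechet_pos α)

lemma ofReal_inv_toReal_mul_frechetMean (hα : α < 1) :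
    ENNReal.ofReal (frechetMean α).toReal⁻¹ * frechetMean α = 1 := by
  rw [ENNReal.ofReal_inv_of_pos
    (ENNReal.toReal_pos (frechetMean_ne_zero α) (frechetMean_ne_top hα)),
    ENNReal.ofReal_toReal (frechetMean_ne_top hα),
    ENNReal.inv_mul_cancel (frechetMean_ne_zero α) (frechetMean_ne_top hα)]

lemma lintegral_weighted_coord (hα : α < 1) (hθ : IsWeights θ) (C : Finset (Fin d)) (i : Fin d) :
    ∫⁻ y, ENNReal.ofReal (weighted α θ C y i) ∂Measure.pi (fun _ => frechet α) =
      ENNReal.ofReal (θ i C) := by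
  have hk : 0 ≤ (frechetMean α).toReal⁻¹ := inv_nonneg.2 ENNReal.toReal_nonneg
  simp only [weighted, ENNReal.ofReal_mul hk, ENNReal.ofReal_mul (hθ.mem_Icc i C).1]
  have h := (measurePreserving_eval (fun _ : Fin d => frechet α) i).lintegral_comp
    (f := fun y : ℝ => ENNReal.ofReal y) (by fun_prop)
  rw [lintegral_const_mul _ (by fun_prop), lintegral_const_mul _ (by fun_prop)]
  change _ * (_ * ∫⁻ y : Fin d → ℝ, ENNReal.ofReal (Function.eval i y) ∂_) = _
  rw [h, mul_left_comm]
  change _ * (_ * frechetMean α) = _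
  rw [ofReal_inv_toReal_mul_frechetMean hα, mul_one]

lemma lintegral_weighted_iSup (hα : α ∈ Set.Ioo (0 : ℝ) 1) (hθ : IsWeights θ)
    (C : Finset (Fin d)) {x : Fin d → ℝ} (hx : ∀ i, 0 < x i) :
    ∫⁻ y, ⨆ i, ENNReal.ofReal (weighted α θ C y i / x i) ∂Measure.pi (fun _ => frechet α) =
      ENNReal.ofReal ((∑ i ∈ C, (θ i C / x i) ^ (1 / α)) ^ α) := by
  have hk : 0 ≤ (frechetMean α).toReal⁻¹ := inv_nonneg.2 ENNReal.toReal_nonneg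
  have hα' : 1 / α ≠ 0 := one_div_ne_zero hα.1.ne'
  have e : ∀ y : Fin d → ℝ, ⨆ i, ENNReal.ofReal (weighted α θ C y i / x i) =
      ENNReal.ofReal (frechetMean α).toReal⁻¹ *
        ⨆ i, ENNReal.ofReal (θ i C / x i * y i) := fun y => by
    rw [ENNReal.mul_iSup]
    refine iSup_congr fun i => ?_
    rw [← ENNReal.ofReal_mul hk]
    congr 1
    simp only [weighted]
    ring
  rw [lintegral_congr e, lintegral_const_mul _ (by fun_prop),
    lintegral_iSup_frechet hα.1 fun i => div_nonneg (hθ.mem_Icc i C).1 (hx i).le, mul_left_comm,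
    ofReal_inv_toReal_mul_frechetMean hα.2, mul_one]
  congr 2
  refine (Finset.sum_subset (Finset.subset_univ C) fun i _ hi => ?_).symm
  rw [hθ.eq_zero_of_notMem i C hi, zero_div, Real.zero_rpow hα']

lemma isGenerator_generator (hα : α ∈ Set.Ioo (0 : ℝ) 1) (hθ : IsWeights θ) :
    IsGenerator (generator α θ) (exponent (fun _ => α) θ) where
  ae_nonneg := by
    rw [generator, ae_finsetSum_measure_iff]
    intro C _
    rw [ae_map_iff (measurable_weighted C).aemeasurable measurableSet_nonneg]
    filter_upwards [ae_pi_frechet_pos] with y hy i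
    exact mul_nonneg (inv_nonneg.2 ENNReal.toReal_nonneg)
      (mul_nonneg (hθ.mem_Icc i C).1 (hy i).le)
  lintegral_coord i := by
    rw [lintegral_generator (by fun_prop)]
    simp only [lintegral_weighted_coord hα.2 hθ]
    rw [← ENNReal.ofReal_sum_of_nonneg fun C _ => (hθ.mem_Icc i C).1, hθ.sum_eq_one,
      ENNReal.ofReal_one]
  lintegral_iSup x hx := by
    rw [lintegral_generator (by fun_prop)]
    simp only [lintegral_weighted_iSup hα hθ _ hx]
    rw [exponent, ENNReal.ofReal_sum_of_nonneg]
    exact fun C _ => Real.rpow_nonneg (Finset.sum_nonneg fun i _ =>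
      Real.rpow_nonneg (div_nonneg (hθ.mem_Icc i C).1 (hx i).le) _) _

/-! ### Masses of the faces of the simplex -/

lemma measurableSet_face (C : Finset (Fin d)) : MeasurableSet (face C) := by
  have hc : ∀ i, Measurable fun w : stdSimplex ℝ (Fin d) => (w : Fin d → ℝ) i := fun i =>
    (measurable_pi_apply i).comp measurable_subtype_coe
  have : face C = (⋂ i, ⋂ (_ : i ∈ C), {w : stdSimplex ℝ (Fin d) | (w : Fin d → ℝ) i ∈
      Set.Ioc (0 : ℝ) 1}) ∩ ⋂ j, ⋂ (_ : j ∉ C), {w | (w : Fin d → ℝ) j = 0} := by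
    ext w
    simp only [face, Set.mem_inter_iff, Set.mem_iInter, Set.mem_ofPred_eq]
  rw [this]
  exact (MeasurableSet.iInter fun i => MeasurableSet.iInter fun _ => hc i measurableSet_Ioc).inter
    (MeasurableSet.iInter fun i => MeasurableSet.iInter fun _ => hc i (measurableSet_singleton 0))

variable [NeZero d]

/-- A nonzero vector points into the relatively open face `C` of the simplex if and only if `C` is
its set of positive coordinates. -/
lemma simplexAngle_mem_face_iff {z : Fin d → ℝ} (hz : 0 < posSum z) (C : Finset (Fin d)) :
    simplexAngle z ∈ face C ↔ ∀ i, i ∈ C ↔ 0 < z i := by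
  have hcoe : ∀ i, (simplexAngle z : Fin d → ℝ) i = max (z i) 0 / posSum z := fun i =>
    congrFun (coe_simplexAngle hz) i
  have hle : ∀ i, max (z i) 0 / posSum z ≤ 1 := fun i =>
    (div_le_one hz).2 (Finset.single_le_sum (f := fun j => max (z j) 0)
      (fun _ _ => le_max_right _ _) (Finset.mem_univ i))
  simp only [face, Set.mem_ofPred_eq, hcoe, Set.mem_Ioc, hle, and_true, div_pos_iff_of_pos_right hz,
    lt_max_iff, lt_irrefl, or_false, div_eq_zero_iff, hz.ne', max_eq_right_iff]
  constructor
  · rintro ⟨h1, h2⟩ i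
    exact ⟨h1 i, fun hi => by_contra fun hC => (h2 i hC).not_gt hi⟩
  · exact fun h => ⟨fun i hi => (h i).1 hi, fun j hj => not_lt.1 fun h0 => hj ((h j).2 h0)⟩

lemma angularMeasure_generator_face (hα : α ∈ Set.Ioo (0 : ℝ) 1) (hθ : IsWeights θ)
    (hnd : ∀ C : Finset (Fin d), (∀ i ∈ C, 0 < θ i C) ∨ (∀ i ∈ C, θ i C = 0))
    {C : Finset (Fin d)} (hC : C.Nonempty) :
    angularMeasure (generator α θ) (face C) =
      (d : ENNReal)⁻¹ * ENNReal.ofReal (∑ i ∈ C, θ i C) := by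
  have hm : MeasurableSet (simplexAngle ⁻¹' face C : Set (Fin d → ℝ)) :=
    measurable_simplexAngle (measurableSet_face C)
  have hk : 0 < (frechetMean α).toReal⁻¹ :=
    inv_pos.2 (ENNReal.toReal_pos (frechetMean_ne_zero α) (frechetMean_ne_top hα.2))
  have hsum : Measurable fun z : Fin d → ℝ => ENNReal.ofReal (posSum z) :=
    continuous_posSum.measurable.ennreal_ofReal
  rw [angularMeasure_apply _ (measurableSet_face C), ← lintegral_indicator hm,
    lintegral_generator (hsum.indicator hm)]
  congr 1
  -- Almost surely the component indexed by `C'` vanishes or has positive coordinates exactly on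
  -- `C'`, so it contributes to the face `C` only for `C' = C`.
  have key : ∀ C' : Finset (Fin d), ∀ᵐ y : Fin d → ℝ ∂Measure.pi (fun _ => frechet α),
      (simplexAngle ⁻¹' face C).indicator (fun z : Fin d → ℝ => ENNReal.ofReal (posSum z))
        (weighted α θ C' y) =
      if C' = C then ENNReal.ofReal (posSum (weighted α θ C' y)) else 0 := by
    intro C'
    filter_upwards [ae_pi_frechet_pos] with y hy
    rcases (posSum_nonneg (weighted α θ C' y)).eq_or_lt with h0 | h0
    · simp [← h0]
    · have hiff : ∀ i, i ∈ C' ↔ 0 < weighted α θ C' y i := by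
        intro i
        have hw : 0 < weighted α θ C' y i ↔ 0 < θ i C' := by
          simp only [weighted]
          rw [mul_pos_iff_of_pos_left hk, mul_pos_iff_of_pos_right (hy i)]
        rw [hw]
        constructor
        · intro hi
          refine (hnd C').resolve_right (fun hz => h0.ne' ?_) i hi
          refine Finset.sum_eq_zero fun j _ => ?_
          have : θ j C' = 0 := by
            by_cases hj : j ∈ C'
            · exact hz j hj
            · exact hθ.eq_zero_of_notMem j C' hj
          simp [weighted, this]
        · intro hi
          by_contra hn
          exact hi.ne' (hθ.eq_zero_of_notMem i C' hn)
      have hmem : weighted α θ C' y ∈ simplexAngle ⁻¹' face C ↔ C' = C := by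
        rw [Set.mem_preimage, simplexAngle_mem_face_iff h0, Finset.ext_iff]
        simp only [← hiff]
        exact forall_congr' fun i => Iff.comm
      by_cases h : C' = C
      · rw [Set.indicator_of_mem (hmem.2 h), if_pos h]
      · rw [Set.indicator_of_notMem (mt hmem.1 h), if_neg h]
  rw [Finset.sum_congr rfl fun C' _ => lintegral_congr_ae (key C'),
    Finset.sum_eq_single_of_mem C (by simpa using hC) fun C' _ hne => by simp [hne]]
  simp only [if_true, ofReal_posSum]
  rw [lintegral_finsetSum _ fun i _ => ?_]
  · simp only [lintegral_weighted_coord hα.2 hθ]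
    rw [ENNReal.ofReal_sum_of_nonneg fun i _ => (hθ.mem_Icc i C).1]
    refine (Finset.sum_subset (Finset.subset_univ C) fun i _ hi => ?_).symm
    rw [hθ.eq_zero_of_notMem i C hi, ENNReal.ofReal_zero]
  · exact ((measurable_pi_apply i).comp (measurable_weighted C)).ennreal_ofReal

end AsymmetricLogistic

end AsymLogistic

theorem proposition1 {d : ℕ} (hd : 1 ≤ d) (α : ℝ) (hα : α ∈ Set.Ioo (0 : ℝ) 1)
    (θ : Fin d → Finset (Fin d) → ℝ) (hθ : AsymLogistic.IsWeights θ)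
    (hnd : ∀ C : Finset (Fin d), (∀ i ∈ C, 0 < θ i C) ∨ (∀ i ∈ C, θ i C = 0))
    {Ω : Type*} [MeasurableSpace Ω] (P : Measure Ω) [IsProbabilityMeasure P]
    (X : Ω → Fin d → ℝ) (hX : AsymLogistic.IsModel P X (fun _ => α) θ) :
    (∃ H : Measure (stdSimplex ℝ (Fin d)), AsymLogistic.IsSpectralMeasure P X H) ∧
      ∀ H : Measure (stdSimplex ℝ (Fin d)), AsymLogistic.IsSpectralMeasure P X H →
        ∀ C : Finset (Fin d), C.Nonempty →
          AsymLogistic.coneMass H C = (1 / (d : ℝ)) * ∑ i ∈ C, θ i C := by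
  have : NeZero d := ⟨by omega⟩
  have h0 := (AsymLogistic.isGenerator_generator hα hθ).isSpectralMeasure hX.measurable hX.cdf_eq
  refine ⟨⟨_, h0⟩, fun H hH C hC => ?_⟩
  rw [hH.unique h0, AsymLogistic.coneMass, measureReal_def,
    AsymLogistic.angularMeasure_generator_face hα hθ hnd hC, ENNReal.toReal_mul,
    ENNReal.toReal_ofReal (Finset.sum_nonneg fun i _ => (hθ.mem_Icc i C).1), one_div]
  simp
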